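/- Let $L$ be a first-order language and let $\mathcal U$ be a saturated $L$-structure whose cardinality $\kappa=|\mathcal U|$ is an (uncountable, strongly) inaccessible cardinal larger than $|L|$. Let $n<\omega$ and let $\mathcal D\subseteq\mathcal U^{n}$ be an arbitrary set. A model is an elementary substructure of $\mathcal U$ of cardinality $<\kappa$. For $B\subseteq\mathcal U$ with $|B|<\kappa$ and $\mathcal C\subseteq\mathcal U^n$, let $o(\mathcal C/B)=\{f[\mathcal C] : f\in\mathrm{Aut}(\mathcal U/B)\}$ be the orbit of $\mathcal C$ under the automorphisms of $\mathcal U$ that fix $B$ pointwise. We say that $\mathcal C$ is invariant over $B$, or $B$-invariant, if $o(\mathcal C/B)=\{\mathcal C\}$, and that $\mathcal C$ is Lascar invariant over $B$ if it is invariant over every model $N\supseteq B$. Let $L(B)$ be the set of first-order formulas with parameters from $B$, and let $L(B;\mathcal C)$ be the set of first-order formulas with parameters from $B$ in the language $L$ expanded by an $n$-ary predicate interpreted as $\mathcal C$. A sequence $\langle a_i : i\in I\rangle$ of finite tuples of $\mathcal U$, all of the same length, indexed by a linear order $I$ is indiscernible in a set of formulas $\Delta$ if $\varphi(a_{i_1},\dots,a_{i_k})\leftrightarrow\varphi(a_{j_1},\dots,a_{j_k})$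 for every $k$, every $i_1<\dots<i_k$ and $j_1<\dots<j_k$ in $I$, and every $\varphi(x_1,\dots,x_k)\in\Delta$. It is $B$-indiscernible if it is indiscernible in $L(B)$, and it is endless if $I$ has no last element. Then, for every model $M$ and every $A\subseteq M$, the following are equivalent: 1. $\mathcal D$ is Lascar invariant over $A$; 2. every set in $o(\mathcal D/A)$ is $M$-invariant; 3. $|o(\mathcal D/A)|<\kappa$; 4. every endless $A$-indiscernible sequence (of finite tuples of any length) is indiscernible in $L(A;\mathcal D)$; 5. $c_0\in\mathcal D\leftrightarrow c_1\in\mathcal D$ for every $A$-indiscernible sequence $c=\langle c_i : i<\omega\rangle$ of elements of $\mathcal U^{n}$. -/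

import Mathlib

open FirstOrder
open scoped Cardinal

universe u v w x

namespace LascarInvariance

/-- The structure `U` is saturated: every set of formulas in one free variable, with parameters
in a set `A ⊆ U` of cardinality less than `|U|`, that is finitely satisfiable in `U` is realized
in `U`. -/
def IsSaturated (L : FirstOrder.Language.{u, v}) (U : Type w) [L.Structure U] : Prop :=
  ∀ A : Set U, #A < #U → ∀ p : Set (L[[A]].Formula Unit),
    (∀ q : Finset (L[[A]].Formula Unit), (q : Set (L[[A]].Formula Unit)) ⊆ p →
      ∃ b : U, ∀ φ ∈ q, φ.Realize (fun _ => b)) →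
    ∃ b : U, ∀ φ ∈ p, φ.Realize (fun _ => b)

/-- The orbit `o(D/A)` of `D ⊆ U ^ n` under the group of automorphisms of `U` that fix `A`
pointwise. -/
def orbit (L : FirstOrder.Language.{u, v}) {U : Type w} [L.Structure U] {n : ℕ}
    (A : Set U) (D : Set (Fin n → U)) : Set (Set (Fin n → U)) :=
  {C | ∃ f : U ≃[L] U, (∀ a ∈ A, f a = a) ∧ (fun c : Fin n → U => f ∘ c) '' D = C}

/-- `D` is invariant over `A` (or `A`-invariant): `o(D/A) = {D}`. -/
def IsInvariant (L : FirstOrder.Language.{u, v}) {U : Type w} [L.Structure U] {n : ℕ}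
    (A : Set U) (D : Set (Fin n → U)) : Prop :=
  orbit L A D = {D}

/-- `D` is Lascar invariant over `A`: it is invariant over every model that contains `A`, where a
model is an elementary substructure of `U` of cardinality less than `|U|`. -/
def IsLascarInvariant (L : FirstOrder.Language.{u, v}) {U : Type w} [L.Structure U] {n : ℕ}
    (A : Set U) (D : Set (Fin n → U)) : Prop :=
  ∀ M : L.ElementarySubstructure U, #M < #U → A ⊆ (M : Set U) → IsInvariant L (M : Set U) D

/-- The relation symbols of the language with a single `n`-ary predicate. -/
inductive PredicateSymbol (n : ℕ) : ℕ → Type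
  | mem : PredicateSymbol n n

/-- The language with a single `n`-ary predicate and no other symbols. -/
abbrev predicateLanguage (n : ℕ) : FirstOrder.Language.{0, 0} :=
  ⟨fun _ => Empty, PredicateSymbol n⟩

/-- The interpretation of the `n`-ary predicate as membership in `D`. -/
@[reducible]
def predicateStructure {U : Type w} {n : ℕ} (D : Set (Fin n → U)) :
    (predicateLanguage n).Structure U where
  funMap := fun f _ => Empty.elim f
  RelMap := fun r => match r with
    | PredicateSymbol.mem => fun c => c ∈ D

/-- A sequence of `m`-tuples of `U`, indexed by a linear order `I`, is indiscernible with respect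
to all formulas of the language `L`. -/
def IsIndiscernible (L : FirstOrder.Language.{u, v}) {U : Type w} [L.Structure U] {m : ℕ}
    {I : Type x} [LinearOrder I] (c : I → Fin m → U) : Prop :=
  ∀ (k : ℕ) (i j : Fin k → I), StrictMono i → StrictMono j →
    ∀ φ : L.Formula (Fin k × Fin m),
      φ.Realize (fun p => c (i p.1) p.2) ↔ φ.Realize (fun p => c (j p.1) p.2)

/-- `A`-indiscernible sequences: indiscernible in `L(A)`. -/
def IsIndiscernibleOver (L : FirstOrder.Language.{u, v}) {U : Type w} [L.Structure U] (A : Set U) {m : ℕ}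
    {I : Type x} [LinearOrder I] (c : I → Fin m → U) : Prop :=
  IsIndiscernible (L[[A]]) c

/-- Sequences indiscernible in `L(A; D)`, the first-order formulas of `L` with parameters in `A`
and a new predicate for `D`. -/
def IsIndiscernibleOverWith (L : FirstOrder.Language.{u, v}) {U : Type w} [L.Structure U] (A : Set U)
    {n : ℕ} (D : Set (Fin n → U)) {m : ℕ}
    {I : Type x} [LinearOrder I] (c : I → Fin m → U) : Prop :=
  letI := predicateStructure D
  IsIndiscernible ((L[[A]]).sum (predicateLanguage n)) c

end LascarInvariance

namespace LascarInvariance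

open FirstOrder.Language Set Filter

/-! ### A transfinite construction -/

/-! The equivalence is proved as a cycle 1 → 2 → 3 → 4 → 5 → 1. Two facts about saturation drive it:
tuples with the same small type are conjugate (`IsSaturated.exists_equiv_fixing`), and finitely
satisfiable sets of formulas in up to `κ` variables over few parameters are realized
(`IsSaturated.exists_realize_formulas`). Both come from one transfinite back-and-forth.

1 → 2 is conjugation by an automorphism over `A`. For 2 → 3, an `M`-invariant set is a union of sets
of realizations of types over `M`, so there are at most `2 ^ 2 ^ |L(M)|` of them, fewer than `κ` by
inaccessibility.

For 3 → 4, a formula with the predicate `D` that separated two consecutive blocks of an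
indiscernible sequence could be tested on a stretched sequence of length `κ`. Each term determines a
set of conjugates of `D`, and there are fewer than `κ` such sets, so two terms determine the same
one; an automorphism over `A` carries this agreement back to the blocks
(`IsSaturated.realizeWith_iff_of_mk_orbit_lt`).

4 → 5 is a special case. For 5 → 1, two tuples with the same type over a model `N` can be continued
by the same coheir sequence into `N`-indiscernible sequences
(`IsSaturated.exists_common_indiscernible_tail`). Membership in `D` of each agrees with that of the
shared next term. -/

theorem exists_superset_of_tasks {X T : Type*} [Nonempty X] (P : Set X → Prop) (task : T → X → Prop)
    (S₀ : Set X) (hfin : ∀ S : Set X, (∀ F ⊆ S, F.Finite → P F) → P S)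
    (hmono : ∀ R S : Set X, R ⊆ S → P S → P R) (h₀ : P S₀)
    (hstep : ∀ (t : T) (R : Set T) (g : T → X), #R < #T → P (S₀ ∪ g '' R) →
      ∃ x, task t x ∧ P (insert x (S₀ ∪ g '' R))) :
    ∃ S, S₀ ⊆ S ∧ P S ∧ ∀ t, ∃ x ∈ S, task t x := by
  -- A well-order of least type makes every `Iio t` smaller than `T`, so `hstep` applies at each
  -- stage. The `epsilon` below is arbitrary until the stage is known to satisfy `P`.
  obtain ⟨_, _, hord⟩ := Cardinal.exists_ord_eq_type_lt T
  let f : T → X := wellFounded_lt.fix fun t ih => Classical.epsilon fun x =>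
    task t x ∧ P (insert x (S₀ ∪ range fun s : Iio t => ih s s.2))
  have hf : ∀ t, f t = Classical.epsilon fun x =>
      task t x ∧ P (insert x (S₀ ∪ f '' Iio t)) := fun t => by
    rw [image_eq_range]
    exact wellFounded_lt.fix_eq _ t
  have spec : ∀ t, P (S₀ ∪ f '' Iio t) →
      task t (f t) ∧ P (insert (f t) (S₀ ∪ f '' Iio t)) := fun t ht => by
    rw [hf t]
    exact Classical.epsilon_spec (hstep t (Iio t) f (Cardinal.mk_Iio_lt t hord) ht)
  -- A finite subset uses finitely many stages, so it lies within what is built at the largest of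
  -- them, where `spec` gives `P`.
  have key : ∀ J : Set T, (∀ s ∈ J, P (S₀ ∪ f '' Iio s)) → P (S₀ ∪ f '' J) := by
    refine fun J hJ => hfin _ fun F hFJ hF => ?_
    have h1 : F \ S₀ ⊆ f '' J := fun x hx => (hFJ hx.1).resolve_left hx.2
    obtain ⟨G, hGJ, hG, hGF⟩ : ∃ G ⊆ J, G.Finite ∧ f '' G = F \ S₀ := by
      obtain ⟨G, hGJ, hG⟩ := (exists_subset_image_finite_and (p := (· = F \ S₀))).1
        ⟨_, h1, hF.sdiff, rfl⟩
      exact ⟨G, hGJ, hG⟩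
    have h2 : F ⊆ S₀ ∪ f '' G := fun x hx => by
      by_cases hxS : x ∈ S₀
      · exact Or.inl hxS
      · exact Or.inr (hGF ▸ ⟨hx, hxS⟩)
    rcases G.eq_empty_or_nonempty with rfl | hne
    · exact hmono _ _ (by simpa using h2) h₀
    · obtain ⟨s, hs, hmax⟩ := hG.exists_maximal hne
      refine hmono _ _ (fun x hx => ?_) (spec s (hJ s (hGJ hs))).2
      rcases h2 hx with hx | ⟨r, hr, rfl⟩
      · exact Or.inr (Or.inl hx)
      · rcases lt_or_ge r s with h | h
        · exact Or.inr (Or.inr ⟨r, h, rfl⟩)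
        · exact Or.inl (congrArg f (le_antisymm (hmax hr h) h))
  have hI : ∀ t, P (S₀ ∪ f '' Iio t) := fun t => by
    induction t using WellFoundedLT.induction with
    | ind t ih => exact key _ ih
  exact ⟨S₀ ∪ f '' univ, subset_union_left, key _ fun s _ => hI s,
    fun t => ⟨f t, Or.inr ⟨t, trivial, rfl⟩, (spec t (hI t)).1⟩⟩

/-! ### Formulas with parameters -/

section Parameters

variable {L : FirstOrder.Language.{u, v}} {U : Type w} [L.Structure U]

theorem realize_constantsVarsEquiv (A : Set U) {α : Type*} (φ : L[[A]].Formula α) (e : α → U) :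
    Formula.Realize (BoundedFormula.constantsVarsEquiv φ : L.Formula (A ⊕ α))
      (Sum.elim (↑) e) ↔ φ.Realize e :=
  BoundedFormula.realize_constantsVarsEquiv

/-- Saturation with the parameters turned into a family of free variables, possibly with
repetitions, so that later arguments stay in `L`. -/
theorem IsSaturated.exists_realize (hU : IsSaturated L U) {ι : Type*} (b : ι → U)
    (hb : #(range b) < #U) (p : Set (L.Formula (ι ⊕ Unit)))
    (hp : ∀ q : Finset (L.Formula (ι ⊕ Unit)), (q : Set _) ⊆ p →
      ∃ x : U, ∀ φ ∈ q, φ.Realize (Sum.elim b fun _ => x)) :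
    ∃ x : U, ∀ φ ∈ p, φ.Realize (Sum.elim b fun _ => x) := by
  classical
  let F : L.Formula (ι ⊕ Unit) → L[[range b]].Formula Unit := fun φ =>
    BoundedFormula.constantsVarsEquiv.symm
      (φ.relabel (Sum.map (rangeFactorization b) id) : L.Formula (range b ⊕ Unit))
  have hF : ∀ (φ : L.Formula (ι ⊕ Unit)) (x : U),
      (F φ).Realize (fun _ => x) ↔ φ.Realize (Sum.elim b fun _ => x) := fun φ x => by
    rw [← realize_constantsVarsEquiv, Equiv.apply_symm_apply, Formula.realize_relabel]
    refine iff_of_eq (congrArg φ.Realize (funext fun i => ?_))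
    cases i <;> rfl
  obtain ⟨x, hx⟩ := hU (range b) hb (F '' p) fun q hq => by
    obtain ⟨q', hq', rfl⟩ := Finset.subset_set_image_iff.1 hq
    obtain ⟨x, hx⟩ := hp q' hq'
    refine ⟨x, fun φ hφ => ?_⟩
    obtain ⟨ψ, hψ, rfl⟩ := Finset.mem_image.1 hφ
    exact (hF ψ x).2 (hx ψ hψ)
  exact ⟨x, fun φ hφ => (hF φ x).1 (hx _ ⟨φ, hφ, rfl⟩)⟩

end Parameters

/-! ### Partial elementary maps -/

section PartialElementary

variable (L : FirstOrder.Language.{u, v}) {U : Type w} [L.Structure U] {V : Type x} [L.Structure V]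

/-- A relation between two structures is partial elementary if tuples that it relates satisfy the
same formulas. -/
def IsPartialElementary (S : Set (V × U)) : Prop :=
  ∀ (k : ℕ) (s : Fin k → V × U), (∀ i, s i ∈ S) → ∀ φ : L.Formula (Fin k),
    φ.Realize (fun i => (s i).1) ↔ φ.Realize (fun i => (s i).2)

variable {L}

theorem IsPartialElementary.realize_iff {S : Set (V × U)} (hS : IsPartialElementary L S)
    {ι : Type*} (s : ι → V × U) (hs : ∀ i, s i ∈ S) (φ : L.Formula ι) :
    φ.Realize (fun i => (s i).1) ↔ φ.Realize (fun i => (s i).2) := by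
  classical
  let e := φ.freeVarFinset.equivFin
  have h := hS _ (fun i => s (e.symm i)) (fun i => hs _) (BoundedFormula.restrictFreeVar φ e)
  rwa [Formula.Realize, Formula.Realize,
    BoundedFormula.realize_restrictFreeVar (fun i => (s i).1) (by simp),
    BoundedFormula.realize_restrictFreeVar (fun i => (s i).2) (by simp)] at h

theorem isPartialElementary_range {ι : Type*} (a : ι → V) (b : ι → U)
    (h : ∀ φ : L.Formula ι, φ.Realize a ↔ φ.Realize b) :
    IsPartialElementary L (range fun i => (a i, b i)) := by
  intro k s hs φ
  choose r hr using hs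
  obtain rfl : s = fun i => (a (r i), b (r i)) := funext fun i => (hr i).symm
  simpa [Formula.realize_relabel, Function.comp_def] using h (φ.relabel r)

theorem IsPartialElementary.mono {R S : Set (V × U)} (h : R ⊆ S) (hS : IsPartialElementary L S) :
    IsPartialElementary L R :=
  fun k s hs φ => hS k s (fun i => h (hs i)) φ

theorem isPartialElementary_of_finite {S : Set (V × U)}
    (h : ∀ F ⊆ S, F.Finite → IsPartialElementary L F) : IsPartialElementary L S :=
  fun k s hs φ => h (range s) (range_subset_iff.2 hs) (finite_range s) k s mem_range_self φ

theorem IsPartialElementary.swap {S : Set (V × U)} (hS : IsPartialElementary L S) :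
    IsPartialElementary L (Prod.swap '' S) := fun k s hs φ =>
  (hS k (fun i => (s i).swap) (fun i => by
    obtain ⟨y, hy, h⟩ := hs i
    rw [← h]; simpa using hy) φ).symm

/-- The type of `y` over the first coordinates, transported to the second ones, is finitely
satisfiable because the relation preserves existential closures of finite conjunctions. Only the
second coordinates need to be few. -/
theorem IsSaturated.exists_insert (hU : IsSaturated L U) {S : Set (V × U)}
    (hS : IsPartialElementary L S) (hc : #(Prod.snd '' S) < #U) (y : V) :
    ∃ z : U, IsPartialElementary L (insert (y, z) S) := by
  obtain ⟨z, hz⟩ := hU.exists_realize (fun s : S => s.1.2)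
    (by rwa [← image_eq_range])
    {φ : L.Formula (S ⊕ Unit) | φ.Realize (Sum.elim (fun s : S => s.1.1) fun _ => y)} fun q hq => by
      have h := hS.realize_iff (fun s : S => s.1) (fun s => s.2)
        ((Formula.iInf fun φ : q => φ.1).iExs Unit)
      rw [Formula.realize_iExs, Formula.realize_iExs] at h
      obtain ⟨z, hz⟩ := h.1 ⟨fun _ => y, by
        rw [Formula.realize_iInf]; exact fun φ => hq φ.2⟩
      rw [Formula.realize_iInf] at hz
      exact ⟨z (), fun φ hφ => hz ⟨φ, hφ⟩⟩
  have hz' : ∀ φ : L.Formula (S ⊕ Unit),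
      φ.Realize (Sum.elim (fun s : S => s.1.1) fun _ => y) ↔
        φ.Realize (Sum.elim (fun s : S => s.1.2) fun _ => z) := fun φ =>
    ⟨fun h => hz φ h, fun h => by
      by_contra hn
      exact Formula.realize_not.1 (hz φ.not (Formula.realize_not.2 hn)) h⟩
  refine ⟨z, (isPartialElementary_range _ _ hz').mono ?_⟩
  rintro s (rfl | hs)
  · exact ⟨Sum.inr (), rfl⟩
  · exact ⟨Sum.inl ⟨s, hs⟩, rfl⟩

end PartialElementary

/-! ### Homogeneity and realization of types in saturated structures -/

section Saturated

variable {L : FirstOrder.Language.{u, v}} {U : Type w} [L.Structure U]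

/-- Back-and-forth: one task for each element of the domain and one for each element of the
codomain. The resulting relation is the graph of a bijection because it preserves equality. -/
theorem IsSaturated.exists_equiv (hU : IsSaturated L U) (hκ : ℵ₀ ≤ #U) {ι : Type*} (a b : ι → U)
    (ha : #(range a) < #U) (hb : #(range b) < #U)
    (h : ∀ φ : L.Formula ι, φ.Realize a ↔ φ.Realize b) :
    ∃ f : U ≃[L] U, ∀ i, f (a i) = b i := by
  have : Nonempty U := Cardinal.mk_ne_zero_iff.1 (Cardinal.aleph0_pos.trans_le hκ).ne'
  obtain ⟨S, hS₀, hS, hT⟩ := exists_superset_of_tasks (T := U ⊕ U) (IsPartialElementary (V := U) L)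
    (Sum.elim (fun y s => s.1 = y) fun z s => s.2 = z) (range fun i => (a i, b i))
    (fun _ => isPartialElementary_of_finite) (fun _ _ h hS => hS.mono h)
    (isPartialElementary_range a b h) fun t R g hR hP => by
      have hR' : #R < #U := by
        rwa [Cardinal.mk_sum, Cardinal.lift_id, Cardinal.add_eq_self hκ] at hR
      rcases t with y | z
      · obtain ⟨z, hz⟩ := hU.exists_insert hP (by
          rw [image_union, ← range_comp, image_image]
          exact (Cardinal.mk_union_le _ _).trans_lt
            (Cardinal.add_lt_of_lt hκ hb (Cardinal.mk_image_le.trans_lt hR'))) y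
        exact ⟨(y, z), rfl, hz⟩
      · obtain ⟨y, hy⟩ := hU.exists_insert hP.swap (by
          rw [image_image, image_union, ← range_comp, image_image]
          exact (Cardinal.mk_union_le _ _).trans_lt
            (Cardinal.add_lt_of_lt hκ ha (Cardinal.mk_image_le.trans_lt hR'))) z
        refine ⟨(y, z), rfl, ?_⟩
        have := hy.swap
        rwa [image_insert_eq, image_image, image_congr (fun s _ => Prod.swap_swap s),
          image_id'] at this
  have h₁ : ∀ y, ∃ z, (y, z) ∈ S := fun y => by
    obtain ⟨s, hs, rfl⟩ := hT (Sum.inl y); exact ⟨s.2, hs⟩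
  have h₂ : ∀ z, ∃ y, (y, z) ∈ S := fun z => by
    obtain ⟨s, hs, rfl⟩ := hT (Sum.inr z); exact ⟨s.1, hs⟩
  have huniq : ∀ s ∈ S, ∀ t ∈ S, s.1 = t.1 ↔ s.2 = t.2 := fun s hs t ht => by
    simpa [Formula.realize_equal] using hS 2 ![s, t]
      (by simp [Fin.forall_fin_two, hs, ht]) ((Term.var 0).equal (Term.var 1))
  choose f hf using h₁
  choose g hg using h₂
  let F : U ↪ₑ[L] U := ⟨f, fun k φ e => (hS k (fun i => (e i, f (e i))) (fun i => hf _) φ).symm⟩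
  refine ⟨⟨⟨f, g, fun y => (huniq _ (hg _) _ (hf _)).2 rfl,
    fun z => (huniq _ (hf _) _ (hg _)).1 rfl⟩, F.map_fun, F.map_rel⟩, fun i => ?_⟩
  exact (huniq _ (hf _) _ (hS₀ ⟨i, rfl⟩)).1 rfl

/-- An ultrapower of `U` realizes the whole set at once. The realization is then copied into `U` one
coordinate at a time, over `b`, by extending a partial elementary relation. -/
theorem IsSaturated.exists_realize_formulas (hU : IsSaturated L U) (hκ : ℵ₀ ≤ #U)
    {α ι : Type*} (b : α → U) (hb : #(range b) < #U)
    (hι : Cardinal.lift.{w} #ι ≤ Cardinal.lift #U) (p : Set (L.Formula (α ⊕ ι)))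
    (hp : ∀ q : Finset (L.Formula (α ⊕ ι)), (q : Set _) ⊆ p →
      ∃ e : ι → U, ∀ φ ∈ q, φ.Realize (Sum.elim b e)) :
    ∃ e : ι → U, ∀ φ ∈ p, φ.Realize (Sum.elim b e) := by
  classical
  have : Nonempty U := Cardinal.mk_ne_zero_iff.1 (Cardinal.aleph0_pos.trans_le hκ).ne'
  have hp' : ∀ q : Finset (L.Formula (α ⊕ ι)), ∃ e : ι → U,
      ∀ φ ∈ q, φ ∈ p → φ.Realize (Sum.elim b e) := fun q => by
    obtain ⟨e, he⟩ := hp (q.filter (· ∈ p)) (fun φ hφ => (Finset.mem_filter.1 hφ).2)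
    exact ⟨e, fun φ hφ hφp => he φ (Finset.mem_filter.2 ⟨hφ, hφp⟩)⟩
  choose e he using hp'
  let 𝒱 : Ultrafilter (Finset (L.Formula (α ⊕ ι))) := Ultrafilter.of atTop
  let V := (𝒱 : Filter (Finset (L.Formula (α ⊕ ι)))).Product fun _ => U
  let c : α ⊕ ι → V := fun i => ((fun q => Sum.elim b (e q) i : _ → U) : V)
  have hc : ∀ φ ∈ p, φ.Realize c := fun φ hφ => by
    refine (Ultraproduct.realize_formula_cast φ fun i q => Sum.elim b (e q) i).2 ?_
    exact Ultrafilter.of_le atTop (mem_of_superset (mem_atTop ({φ} : Finset (L.Formula (α ⊕ ι)))) fun q hq =>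
      he q φ (Finset.singleton_subset_iff.1 hq) hφ)
  -- The parameters sit diagonally in the ultrapower, so the relation that matches them with `b` is
  -- partial elementary.
  have hb' : ∀ φ : L.Formula α, φ.Realize (fun i => c (Sum.inl i)) ↔ φ.Realize b := fun φ =>
    (Ultraproduct.realize_formula_cast φ fun i _ => b i).trans eventually_const
  obtain ⟨S, hS₀, hS, hT⟩ := exists_superset_of_tasks (T := ι) (IsPartialElementary (U := U) L)
    (fun i s => s.1 = c (Sum.inr i)) (range fun i => (c (Sum.inl i), b i))
    (fun _ => isPartialElementary_of_finite) (fun _ _ h hS => hS.mono h)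
    (isPartialElementary_range _ b hb') fun i R g hR hP => by
      obtain ⟨z, hz⟩ := hU.exists_insert hP (by
          rw [image_union, ← range_comp, image_image]
          refine (Cardinal.mk_union_le _ _).trans_lt (Cardinal.add_lt_of_lt hκ hb ?_)
          refine Cardinal.lift_lt.1 (Cardinal.mk_image_le_lift.trans_lt ?_)
          exact (Cardinal.lift_lt.2 hR).trans_le hι) (c (Sum.inr i))
      exact ⟨_, rfl, hz⟩
  have hT' : ∀ i, ∃ z, (c (Sum.inr i), z) ∈ S := fun i => by
    obtain ⟨s, hs, h⟩ := hT i; exact ⟨s.2, h ▸ hs⟩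
  choose d hd using hT'
  refine ⟨d, fun φ hφ => (hS.realize_iff (fun i => (c i, Sum.elim b d i)) ?_ φ).1 (hc φ hφ)⟩
  rintro (i | i)
  exacts [hS₀ ⟨i, rfl⟩, hd i]

/-- Tuples with the same type over a small set are conjugate over it. -/
theorem IsSaturated.exists_equiv_fixing (hU : IsSaturated L U) (hκ : ℵ₀ ≤ #U) {A : Set U}
    (hA : #A < #U) {ι : Type*} [Finite ι] (a b : ι → U)
    (h : ∀ φ : L.Formula (A ⊕ ι), φ.Realize (Sum.elim (↑) a) ↔ φ.Realize (Sum.elim (↑) b)) :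
    ∃ f : U ≃[L] U, (∀ x ∈ A, f x = x) ∧ f ∘ a = b := by
  have hr : ∀ c : ι → U, #(range (Sum.elim ((↑) : A → U) c)) < #U := fun c => by
    rw [Sum.elim_range, Subtype.range_coe]
    exact (Cardinal.mk_union_le _ _).trans_lt (Cardinal.add_lt_of_lt hκ hA
      ((Cardinal.lt_aleph0_iff_set_finite.2 (finite_range c)).trans_le hκ))
  obtain ⟨f, hf⟩ := hU.exists_equiv hκ _ _ (hr a) (hr b) h
  exact ⟨f, fun x hx => hf (Sum.inl ⟨x, hx⟩), funext fun i => hf (Sum.inr i)⟩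

end Saturated

/-! ### Invariance -/

section Invariance

variable {L : FirstOrder.Language.{u, v}} {U : Type w} [L.Structure U] {n : ℕ}

theorem isInvariant_iff {A : Set U} {D : Set (Fin n → U)} :
    IsInvariant L A D ↔
      ∀ f : U ≃[L] U, (∀ a ∈ A, f a = a) → ∀ c : Fin n → U, f ∘ c ∈ D ↔ c ∈ D := by
  constructor
  · intro h f hf c
    have hD : (fun c : Fin n → U => f ∘ c) '' D = D := by
      have : (fun c : Fin n → U => f ∘ c) '' D ∈ orbit L A D := ⟨f, hf, rfl⟩
      rwa [h] at this
    conv_lhs => rw [← hD]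
    exact f.injective.comp_left.mem_set_image
  · intro h
    refine eq_singleton_iff_unique_mem.2 ⟨⟨Language.Equiv.refl L U, fun _ _ => rfl, ?_⟩, ?_⟩
    · exact image_id D
    · rintro _ ⟨f, hf, rfl⟩
      ext c
      constructor
      · rintro ⟨c, hc, rfl⟩
        exact (h f hf c).2 hc
      · intro hc
        have hc' : f ∘ (f.symm ∘ c) = c := funext fun i => f.apply_symm_apply _
        exact ⟨f.symm ∘ c, (h f hf _).1 (hc'.symm ▸ hc), hc'⟩

/-- The range of an elementary embedding is an elementary substructure. -/
theorem exists_elementarySubstructure_range {M : Type*} [L.Structure M] (F : M ↪ₑ[L] U) :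
    ∃ N : L.ElementarySubstructure U, (N : Set U) = range F := by
  let e := F.toEmbedding.equivRange
  refine ⟨⟨F.toEmbedding.toHom.range, fun k φ y => ?_⟩, F.toEmbedding.toHom.range_coe⟩
  have hy : e ∘ (e.symm ∘ y) = y := funext fun i => e.apply_symm_apply _
  have hy' : ((↑) : _ → U) ∘ y = F ∘ (e.symm ∘ y) := by
    conv_lhs => rw [← hy]
    rfl
  rw [hy', F.map_formula, ← StrongHomClass.realize_formula e, hy]

/-- If `C = g[D]`, then `g⁻¹[M]` is again a model containing `A`, so `D` is invariant over it;
conjugating by `g` gives invariance of `C` over `M`. -/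
theorem IsLascarInvariant.isInvariant_of_mem_orbit {A : Set U} {D : Set (Fin n → U)}
    (h : IsLascarInvariant L A D) (M : L.ElementarySubstructure U) (hM : #M < #U)
    (hAM : A ⊆ (M : Set U)) {C : Set (Fin n → U)} (hC : C ∈ orbit L A D) :
    IsInvariant L (M : Set U) C := by
  obtain ⟨g, hg, rfl⟩ := hC
  obtain ⟨N, hN⟩ := exists_elementarySubstructure_range
    (g.symm.toElementaryEmbedding.comp M.subtype)
  have hN' : (N : Set U) = g.symm '' M := by
    rw [hN, image_eq_range]; rfl
  have hD := isInvariant_iff.1 (h N (by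
    refine (le_of_eq_of_le ?_ (Cardinal.mk_image_le (f := g.symm) (s := (M : Set U)))).trans_lt hM
    rw [← hN']; rfl) (by
    rw [hN']
    exact fun a ha => ⟨a, hAM ha, g.injective (by rw [g.apply_symm_apply, hg a ha])⟩))
  refine isInvariant_iff.2 fun f hf c => ?_
  have key : ∀ c : Fin n → U, c ∈ (fun c : Fin n → U => g ∘ c) '' D ↔ g.symm ∘ c ∈ D := fun c => by
    rw [← g.injective.comp_left.mem_set_image (s := D)]
    exact iff_of_eq (congrArg (· ∈ _) (funext fun i => (g.apply_symm_apply _).symm))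
  rw [key, key, ← hD ((g.symm.comp f).comp g) (by
    rw [hN']
    rintro _ ⟨a, ha, rfl⟩
    simp [hf a ha]) (g.symm ∘ c)]
  refine iff_of_eq (congrArg (· ∈ D) (funext fun i => ?_))
  simp

end Invariance

/-! ### Counting invariant sets -/

section Counting

variable {L : FirstOrder.Language.{u, v}} {U : Type w} [L.Structure U] {n : ℕ}

theorem mk_formula_lt {κ : Cardinal.{w}} (hκ : ℵ₀ < κ)
    (hL : Cardinal.lift.{w} L.card < Cardinal.lift.{max u v} κ) {α : Type w} (hα : #α < κ) :
    #(L.Formula α) < Cardinal.lift.{max u v} κ := by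
  have h₁ : #(L.Formula α) ≤ #(Σ k, L.BoundedFormula α k) :=
    Cardinal.mk_le_of_injective (f := fun φ : L.Formula α => (⟨0, φ⟩ : Σ k, L.BoundedFormula α k))
      fun φ ψ h => by simpa using h
  have hκ' : ℵ₀ < Cardinal.lift.{max u v} κ := by simpa using hκ
  refine (h₁.trans BoundedFormula.card_le).trans_lt (max_lt hκ' ?_)
  exact Cardinal.add_lt_of_lt hκ'.le (Cardinal.lift_lt.2 hα) hL

/-- In a saturated structure, a set invariant over a small set is determined by the types that
are realized in it. -/
theorem IsSaturated.mk_setOf_isInvariant_lt (hU : IsSaturated L U) (hκ : (#U).IsInaccessible)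
    (hL : Cardinal.lift.{w} L.card < Cardinal.lift.{max u v} #U) {A : Set U} (hA : #A < #U) :
    #{C : Set (Fin n → U) | IsInvariant L A C} < #U := by
  let tp : (Fin n → U) → Set (L.Formula (A ⊕ Fin n)) := fun c =>
    {φ | φ.Realize (Sum.elim (↑) c)}
  have hinj : Function.Injective fun C : {C : Set (Fin n → U) | IsInvariant L A C} => tp '' C.1 := by
    have key : ∀ C C' : Set (Fin n → U), IsInvariant L A C' → tp '' C ⊆ tp '' C' → C ⊆ C' := by
      intro C C' hC' h c hc
      obtain ⟨c', hc', htp⟩ := h ⟨c, hc, rfl⟩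
      obtain ⟨f, hf, rfl⟩ := hU.exists_equiv_fixing hκ.aleph0_lt.le hA c c'
        fun φ => iff_of_eq (congrArg (φ ∈ ·) htp.symm)
      exact (isInvariant_iff.1 hC' f hf c).1 hc'
    exact fun C C' h => Subtype.ext
      ((key _ _ C'.2 (le_of_eq h)).antisymm (key _ _ C.2 (le_of_eq h.symm)))
  have hα : #(A ⊕ Fin n) < #U := by
    rw [Cardinal.mk_sum, Cardinal.lift_uzero, Cardinal.mk_fin, Cardinal.lift_natCast]
    exact Cardinal.add_lt_of_lt hκ.aleph0_lt.le hA (hκ.nat_lt n)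
  obtain ⟨c, hc, hcΦ⟩ := Cardinal.lt_lift_iff.1 (mk_formula_lt hκ.aleph0_lt hL hα)
  rw [← Cardinal.lift_lt.{w, max u v w}]
  refine (Cardinal.lift_mk_le_lift_mk_of_injective hinj).trans_lt ?_
  rw [Cardinal.mk_set, Cardinal.mk_set, ← hcΦ]
  rw [← Cardinal.lift_two_power, ← Cardinal.lift_two_power, Cardinal.lift_lift]
  -- A set of types is a set of sets of formulas, hence two uses of the strong limit property.
  exact Cardinal.lift_lt.2 (hκ.isStrongPrelimit (hκ.isStrongPrelimit hc))

end Counting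

/-! ### Indiscernible sequences -/

section Indiscernible

variable {L : FirstOrder.Language.{u, v}} {U : Type w} [L.Structure U] {m n : ℕ}

theorem isIndiscernibleOver_iff {A : Set U} {I : Type x} [LinearOrder I] {c : I → Fin m → U} :
    IsIndiscernibleOver L A c ↔ ∀ (k : ℕ) (i j : Fin k → I), StrictMono i → StrictMono j →
      ∀ φ : L.Formula (A ⊕ (Fin k × Fin m)),
        φ.Realize (Sum.elim (↑) fun p => c (i p.1) p.2) ↔
          φ.Realize (Sum.elim (↑) fun p => c (j p.1) p.2) := by
  constructor
  · intro h k i j hi hj φ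
    have := h k i j hi hj (BoundedFormula.constantsVarsEquiv.symm φ)
    rwa [← realize_constantsVarsEquiv, ← realize_constantsVarsEquiv, Equiv.apply_symm_apply] at this
  · intro h k i j hi hj φ
    have := h k i j hi hj (BoundedFormula.constantsVarsEquiv φ)
    rwa [realize_constantsVarsEquiv, realize_constantsVarsEquiv] at this

theorem IsIndiscernibleOver.mono {A B : Set U} (hAB : A ⊆ B) {I : Type x} [LinearOrder I]
    {c : I → Fin m → U} (h : IsIndiscernibleOver L B c) : IsIndiscernibleOver L A c :=
  isIndiscernibleOver_iff.2 fun k i j hi hj φ => by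
    have := isIndiscernibleOver_iff.1 h k i j hi hj (φ.relabel (Sum.map (inclusion hAB) id))
    rwa [Formula.realize_relabel, Formula.realize_relabel, Sum.elim_comp_map,
      Sum.elim_comp_map] at this

/-- The truth value of a formula of `L(A)` expanded by a predicate that is interpreted as `D`. -/
def RealizeWith {A : Set U} (D : Set (Fin n → U)) {α : Type*}
    (φ : ((L[[A]]).sum (predicateLanguage n)).Formula α) (e : α → U) : Prop :=
  letI := predicateStructure D
  φ.Realize e

theorem relMap_mem (D : Set (Fin n → U)) (c : Fin n → U) :
    @Structure.RelMap _ U (predicateStructure D) n PredicateSymbol.mem c ↔ c ∈ D :=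
  Iff.rfl

/-- Such an `f` is an isomorphism between two expansions of the same structure `U`, by `D` and by
`D'`; hence the explicit instances. -/
theorem realizeWith_comp {A : Set U} {D D' : Set (Fin n → U)} (f : U ≃[L] U)
    (hf : ∀ a ∈ A, f a = a) (hD : ∀ c : Fin n → U, f ∘ c ∈ D' ↔ c ∈ D) {α : Type*}
    (φ : ((L[[A]]).sum (predicateLanguage n)).Formula α) (e : α → U) :
    RealizeWith D' φ (f ∘ e) ↔ RealizeWith D φ e := by
  let S := @Language.sumStructure (L[[A]]) (predicateLanguage n) U _ (predicateStructure D)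
  let S' := @Language.sumStructure (L[[A]]) (predicateLanguage n) U _ (predicateStructure D')
  let g : @Language.Equiv ((L[[A]]).sum (predicateLanguage n)) U U S S' :=
    @Language.Equiv.mk _ U U S S' f.toEquiv
      (by
        rintro k ((F | a) | F) e
        · exact f.map_fun F e
        · cases k with
          | zero => exact hf _ a.2
          | succ k => exact isEmptyElim a
        · exact F.elim)
      (by
        rintro k ((R | R) | R) e
        · exact f.map_rel R e
        · exact isEmptyElim R
        · cases R
          exact (relMap_mem D' _).trans ((hD e).trans (relMap_mem D e).symm))
  exact @StrongHomClass.realize_formula _ U U S S' α _ _ _ g φ e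

/-- Concatenating two increasing tuples, the first below the second, gives an increasing tuple. -/
theorem strictMono_append {I : Type x} [LinearOrder I] {k l : ℕ} {i : Fin k → I} {j : Fin l → I}
    (hi : StrictMono i) (hj : StrictMono j) (hij : ∀ r s, i r < j s) :
    StrictMono (Fin.append i j) := by
  intro r s hrs
  induction r using Fin.addCases with
  | left r =>
    induction s using Fin.addCases with
    | left s => simpa using hi (show r < s from hrs)
    | right s => simpa using hij r s
  | right r =>
    induction s using Fin.addCases with
    | left s =>
      simp only [Fin.lt_def, Fin.val_natAdd, Fin.val_castAdd] at hrs
      omega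
    | right s => simpa using hj ((Fin.natAdd_lt_natAdd_iff k).1 hrs)

/-- The type of a pair that occurs as the type of all increasing pairs of an infinite sequence
also occurs so in a sequence indexed by any given linear order that is not too long. -/
theorem IsSaturated.exists_pairwise_realize (hU : IsSaturated L U) (hκ : ℵ₀ ≤ #U) {A : Set U}
    (hA : #A < #U) {ι : Type*} [Finite ι] (a b : ι → U) (d : ℕ → ι → U)
    (hd : ∀ r s, r < s → ∀ φ : L.Formula (A ⊕ (ι ⊕ ι)),
      φ.Realize (Sum.elim (↑) (Sum.elim a b)) ↔ φ.Realize (Sum.elim (↑) (Sum.elim (d r) (d s))))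
    {W : Type w} [LinearOrder W] (hW : #W ≤ #U) :
    ∃ e : W → ι → U, ∀ s t : W, s < t → ∀ φ : L.Formula (A ⊕ (ι ⊕ ι)),
      φ.Realize (Sum.elim (↑) (Sum.elim a b)) ↔
        φ.Realize (Sum.elim (↑) (Sum.elim (e s) (e t))) := by
  classical
  let ρ : W → W → A ⊕ (ι ⊕ ι) → A ⊕ (W × ι) := fun s t =>
    Sum.map id (Sum.elim (fun i => (s, i)) fun i => (t, i))
  have hρ : ∀ (s t : W) (φ : L.Formula (A ⊕ (ι ⊕ ι))) (e : W × ι → U),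
      (φ.relabel (ρ s t)).Realize (Sum.elim (↑) e) ↔
        φ.Realize (Sum.elim (↑) (Sum.elim (fun i => e (s, i)) fun i => e (t, i))) :=
    fun s t φ e => by
      rw [Formula.realize_relabel]
      refine iff_of_eq (congrArg φ.Realize (funext fun i => ?_))
      rcases i with i | i | i <;> rfl
  obtain ⟨e, he⟩ := hU.exists_realize_formulas hκ ((↑) : A → U) (by simpa using hA)
    (ι := W × ι) (by
      rw [Cardinal.mk_prod, Cardinal.lift_mul, Cardinal.lift_lift, Cardinal.lift_lift]
      have hκ' : ℵ₀ ≤ Cardinal.lift #U := Cardinal.aleph0_le_lift.2 hκ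
      exact Cardinal.mul_le_of_le hκ' (Cardinal.lift_le.2 hW)
        ((Cardinal.lift_lt_aleph0.2 (Cardinal.mk_lt_aleph0 (α := ι))).le.trans hκ'))
    {ψ | ∃ (s t : W) (φ : L.Formula (A ⊕ (ι ⊕ ι))), s < t ∧ φ.Realize (Sum.elim (↑) (Sum.elim a b)) ∧
      φ.relabel (ρ s t) = ψ} fun q hq => by
      have hq' : ∀ ψ : q, ∃ (s t : W) (φ : L.Formula (A ⊕ (ι ⊕ ι))), s < t ∧
          φ.Realize (Sum.elim (↑) (Sum.elim a b)) ∧ φ.relabel (ρ s t) = ψ.1 :=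
        fun ψ => hq ψ.2
      choose s t φ hst hφ hψ using hq'
      let F : Finset W := Finset.univ.image s ∪ Finset.univ.image t
      -- Only the indices in the finite set `F` matter; ranking them by the number of smaller
      -- elements of `F` maps them increasingly into `ℕ`.
      refine ⟨fun p => d (F.filter (· < p.1)).card p.2, fun ψ hψq => ?_⟩
      have h := hψ ⟨ψ, hψq⟩
      simp only at h
      rw [← h, hρ]
      refine (hd (F.filter (· < s ⟨ψ, hψq⟩)).card (F.filter (· < t ⟨ψ, hψq⟩)).card ?_ _).1
        (hφ ⟨ψ, hψq⟩)
      refine Finset.card_lt_card (Finset.ssubset_iff_of_subset ?_ |>.2 ?_)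
      · intro z hz
        rw [Finset.mem_filter] at hz ⊢
        exact ⟨hz.1, hz.2.trans (hst _)⟩
      · exact ⟨s ⟨ψ, hψq⟩, by simp [F, hst], by simp⟩
  refine ⟨fun s i => e (s, i), fun s t hst φ => ⟨fun h => ?_, fun h => ?_⟩⟩
  · exact (hρ s t φ e).1 (he _ ⟨s, t, φ, hst, h, rfl⟩)
  · by_contra hn
    exact Formula.realize_not.1
      ((hρ s t φ.not e).1 (he _ ⟨s, t, φ.not, hst, Formula.realize_not.2 hn, rfl⟩)) h

/-- If the orbit of `D` is small then a formula with a predicate for `D` does not separate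
a pair whose type is that of all increasing pairs of an infinite sequence. -/
theorem IsSaturated.realizeWith_iff_of_mk_orbit_lt (hU : IsSaturated L U)
    (hκ : (#U).IsInaccessible) {A : Set U} (hA : #A < #U) {D : Set (Fin n → U)}
    (hD : #(orbit L A D) < #U) {ι : Type*} [Finite ι] (a b : ι → U) (d : ℕ → ι → U)
    (hd : ∀ r s, r < s → ∀ φ : L.Formula (A ⊕ (ι ⊕ ι)),
      φ.Realize (Sum.elim (↑) (Sum.elim a b)) ↔ φ.Realize (Sum.elim (↑) (Sum.elim (d r) (d s))))
    (φ : ((L[[A]]).sum (predicateLanguage n)).Formula ι) :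
    RealizeWith D φ a ↔ RealizeWith D φ b := by
  obtain ⟨_, _, -⟩ := Cardinal.exists_ord_eq_type_lt U
  obtain ⟨e, he⟩ := hU.exists_pairwise_realize hκ.aleph0_lt.le hA a b d hd (W := U) le_rfl
  -- An injection would give `κ ≤ 2 ^ |o(D/A)|`, against the strong limit property.
  have hni : ¬ Function.Injective fun s : U => {C : orbit L A D | RealizeWith C.1 φ (e s)} :=
    fun hi => ((Cardinal.mk_le_of_injective hi).trans_eq (Cardinal.mk_set)).not_gt
      (hκ.isStrongPrelimit hD)
  obtain ⟨s, t, hst, hlt⟩ : ∃ s t, {C : orbit L A D | RealizeWith C.1 φ (e s)} =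
      {C : orbit L A D | RealizeWith C.1 φ (e t)} ∧ s < t := by
    simp only [Function.Injective, not_forall] at hni
    obtain ⟨s, t, hst, hne⟩ := hni
    rcases lt_or_gt_of_ne hne with h | h
    exacts [⟨s, t, hst, h⟩, ⟨t, s, hst.symm, h⟩]
  obtain ⟨f, hf, hfe⟩ := hU.exists_equiv_fixing hκ.aleph0_lt.le hA _ _ (he s t hlt)
  have h₀ : f ∘ a = e s := funext fun i => congrFun hfe (Sum.inl i)
  have h₁ : f ∘ b = e t := funext fun i => congrFun hfe (Sum.inr i)
  have hr := realizeWith_comp (D' := (fun c : Fin n → U => f ∘ c) '' D) f hf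
    (fun c => f.injective.comp_left.mem_set_image) φ
  rw [← hr, ← hr, h₀, h₁]
  exact iff_of_eq (congrArg (⟨(fun c : Fin n → U => f ∘ c) '' D, f, hf, rfl⟩ ∈ ·) hst)

/-- If `i` lies entirely below `j`, the pair of blocks has the type of any two successive blocks of
length `k` along an increasing `ω`-sequence, so the previous lemma applies. In general both are
compared with a block beyond them, which exists because the sequence is endless. -/
theorem IsSaturated.isIndiscernibleOverWith_of_mk_orbit_lt (hU : IsSaturated L U)
    (hκ : (#U).IsInaccessible) {A : Set U} (hA : #A < #U) {D : Set (Fin n → U)}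
    (hD : #(orbit L A D) < #U) {I : Type x} [LinearOrder I] [NoMaxOrder I] {c : I → Fin m → U}
    (hc : IsIndiscernibleOver L A c) : IsIndiscernibleOverWith L A D c := by
  intro k i j hi hj φ
  rcases Nat.eq_zero_or_pos k with rfl | hk
  · rw [Subsingleton.elim i j]
  have : Nonempty I := ⟨i ⟨0, hk⟩⟩
  rw [isIndiscernibleOver_iff] at hc
  have key : ∀ i j : Fin k → I, StrictMono i → StrictMono j → (∀ r s, i r < j s) →
      (RealizeWith D φ (fun p => c (i p.1) p.2) ↔ RealizeWith D φ (fun p => c (j p.1) p.2)) := by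
    intro i j hi hj hij
    obtain ⟨e, he⟩ := Nat.exists_strictMono I
    have hlt : ∀ {r s : ℕ} (p q : Fin k), r < s → r * k + p < s * k + q := fun {r s} p q hrs => by
      have := Nat.mul_le_mul_right k (Nat.succ_le_of_lt hrs)
      rw [Nat.succ_mul] at this
      omega
    have hmono : ∀ r, StrictMono fun p : Fin k => e (r * k + p) := fun r p q hpq =>
      he (Nat.add_lt_add_left hpq _)
    refine hU.realizeWith_iff_of_mk_orbit_lt hκ hA hD _ _
      (fun r p => c (e (r * k + p.1)) p.2) (fun r s hrs ψ => ?_) φ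
    have h := hc _ _ _ (strictMono_append hi hj hij) (strictMono_append (hmono r) (hmono s)
      fun p q => he (hlt p q hrs)) (ψ.relabel (Sum.map id (Sum.elim
        (fun p => (Fin.castAdd k p.1, p.2)) fun p => (Fin.natAdd k p.1, p.2))))
    rw [Formula.realize_relabel, Formula.realize_relabel, Sum.elim_comp_map, Sum.elim_comp_map,
      Sum.comp_elim, Sum.comp_elim] at h
    simpa only [Function.comp_def, Fin.append_left, Fin.append_right, id_eq] using h
  obtain ⟨b, hb⟩ : ∃ b, ∀ r, i r < b ∧ j r < b := by
    obtain ⟨b, hb⟩ := (finite_range i |>.union (finite_range j)).bddAbove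
    obtain ⟨b', hb'⟩ := exists_gt b
    exact ⟨b', fun r => ⟨(hb (Or.inl ⟨r, rfl⟩)).trans_lt hb', (hb (Or.inr ⟨r, rfl⟩)).trans_lt hb'⟩⟩
  have : NoMaxOrder (Ici b) := inferInstance
  have : Nonempty (Ici b) := ⟨⟨b, le_rfl⟩⟩
  obtain ⟨l, hl⟩ := Nat.exists_strictMono (Ici b)
  have hl' : StrictMono fun r : Fin k => (l r : I) := fun r s hrs => hl hrs
  exact (key i _ hi hl' fun r s => (hb r).1.trans_le (l s).2).trans
    (key j _ hj hl' fun r s => (hb r).2.trans_le (l s).2).symm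

end Indiscernible

/-! ### Coheir sequences -/

section Coheir

variable {L : FirstOrder.Language.{u, v}} {U : Type w} [L.Structure U] {n : ℕ}

/-- The tuple `c` realizes over `B` the global type, finitely satisfiable in `N`, that is given by
the ultrafilter `𝒱`. -/
def RealizesOver {N : L.ElementarySubstructure U} (𝒱 : Ultrafilter (Fin n → N)) (B : Set U)
    (c : Fin n → U) : Prop :=
  ∀ φ : L.Formula (B ⊕ Fin n), φ.Realize (Sum.elim (↑) c) ↔
    ∀ᶠ y : Fin n → N in 𝒱, φ.Realize (Sum.elim (↑) fun r => (y r : U))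

variable {N : L.ElementarySubstructure U} {𝒱 : Ultrafilter (Fin n → N)}

theorem RealizesOver.realize_iff {B : Set U} {c : Fin n → U} (h : RealizesOver 𝒱 B c) {β : Type*}
    (e : β → U) (he : ∀ i, e i ∈ B) (φ : L.Formula (β ⊕ Fin n)) :
    φ.Realize (Sum.elim e c) ↔ ∀ᶠ y : Fin n → N in 𝒱, φ.Realize (Sum.elim e fun r => (y r : U)) := by
  have := h (φ.relabel (Sum.map (fun i => ⟨e i, he i⟩) id))
  simp only [Formula.realize_relabel, Sum.elim_comp_map] at this
  exact this

theorem RealizesOver.mono {B C : Set U} (hCB : C ⊆ B) {c : Fin n → U} (h : RealizesOver 𝒱 B c) :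
    RealizesOver 𝒱 C c :=
  h.realize_iff _ fun i => hCB i.2

/-- Since `N` is elementary, each finite part of the type of `a` over `N` is realized in `N`; an
ultrafilter collects these realizations. -/
theorem exists_ultrafilter_realizesOver (N : L.ElementarySubstructure U) (a : Fin n → U) :
    ∃ 𝒱 : Ultrafilter (Fin n → N), RealizesOver 𝒱 (N : Set U) a := by
  classical
  have h : ∀ q : Finset (L.Formula (N ⊕ Fin n)), ∃ y : Fin n → N, ∀ φ ∈ q,
      φ.Realize (Sum.elim ((↑) : N → U) a) →
        φ.Realize (Sum.elim ((↑) : N → U) fun r => (y r : U)) := fun q => by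
    let ψ : L.Formula N := (Formula.iInf fun φ : q.filter fun φ =>
      φ.Realize (Sum.elim ((↑) : N → U) a) => φ.1).iExs (Fin n)
    have hψ : ψ.Realize ((↑) : N → U) := by
      rw [Formula.realize_iExs]
      refine ⟨a, ?_⟩
      rw [Formula.realize_iInf]
      exact fun φ => (Finset.mem_filter.1 φ.2).2
    have hψ' : ψ.Realize (id : N → N) := (N.subtype.map_formula ψ id).1 hψ
    rw [Formula.realize_iExs] at hψ'
    obtain ⟨y, hy⟩ := hψ'
    rw [Formula.realize_iInf] at hy
    refine ⟨y, fun φ hφ hφa => ?_⟩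
    have := (N.subtype.map_formula φ _).2 (hy ⟨φ, Finset.mem_filter.2 ⟨hφ, hφa⟩⟩)
    rwa [Sum.comp_elim] at this
  choose y hy using h
  have key : ∀ φ : L.Formula (N ⊕ Fin n), φ.Realize (Sum.elim ((↑) : N → U) a) →
      ∀ᶠ z : Fin n → N in (Ultrafilter.of atTop).map y,
        φ.Realize (Sum.elim ((↑) : N → U) fun r => (z r : U)) := fun φ hφ =>
    Ultrafilter.of_le atTop (mem_of_superset (mem_atTop ({φ} : Finset (L.Formula (N ⊕ Fin n))))
      fun q hq => hy q φ (Finset.singleton_subset_iff.1 hq) hφ)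
  refine ⟨(Ultrafilter.of atTop).map y, fun φ => ⟨key φ, fun h => ?_⟩⟩
  by_contra hn
  have := key φ.not (Formula.realize_not.2 hn)
  simp only [Formula.realize_not] at this
  exact Ultrafilter.eventually_not.1 this h

theorem IsSaturated.exists_realizesOver (hU : IsSaturated L U) (hκ : ℵ₀ ≤ #U)
    (𝒱 : Ultrafilter (Fin n → N)) {B : Set U} (hB : #B < #U) : ∃ c, RealizesOver 𝒱 B c := by
  obtain ⟨c, hc⟩ := hU.exists_realize_formulas hκ ((↑) : B → U) (by simpa using hB)
    (ι := Fin n) (by simpa using (Cardinal.natCast_lt_aleph0.trans_le hκ).le)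
    {φ | ∀ᶠ y : Fin n → N in 𝒱, φ.Realize (Sum.elim (↑) fun r => (y r : U))} fun q hq => by
      obtain ⟨y, hy⟩ := ((eventually_all_finset q).2 fun φ hφ => hq hφ).exists
      exact ⟨_, hy⟩
  refine ⟨c, fun φ => ⟨fun h => ?_, hc φ⟩⟩
  by_contra hn
  refine Formula.realize_not.1 (hc φ.not ?_) h
  simpa only [mem_ofPred_eq, Formula.realize_not] using Ultrafilter.eventually_not.2 hn

/-- Whether `φ` holds of an increasing tuple is decided by letting the last entry range over `N`
along `𝒱`. For each such value `φ` becomes a formula over `N` in a shorter tuple, and induction on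
the length applies. -/
theorem isIndiscernibleOver_of_realizesOver {c : ℕ → Fin n → U}
    (hc : ∀ k, RealizesOver 𝒱 ((N : Set U) ∪ ⋃ j ∈ Iio k, range (c j)) (c k)) :
    IsIndiscernibleOver L (N : Set U) c := by
  rw [isIndiscernibleOver_iff]
  have key : ∀ (k : ℕ) (i : Fin k → ℕ), StrictMono i →
      ∀ φ : L.Formula ((N : Set U) ⊕ (Fin k × Fin n)),
        φ.Realize (Sum.elim (↑) fun p => c (i p.1) p.2) ↔
          φ.Realize (Sum.elim (↑) fun p => c p.1 p.2) := by
    intro k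
    induction k with
    | zero =>
      intro i _ φ
      refine iff_of_eq (congrArg φ.Realize (congrArg _ (funext fun p => p.1.elim0)))
    | succ k ih =>
      intro i hi φ
      let ρ : (N : Set U) ⊕ (Fin (k + 1) × Fin n) → ((N : Set U) ⊕ (Fin k × Fin n)) ⊕ Fin n :=
        Sum.elim (fun a => Sum.inl (Sum.inl a)) fun p =>
          Fin.lastCases (Sum.inr p.2) (fun s => Sum.inl (Sum.inr (s, p.2))) p.1
      have hρ : ∀ t : Fin (k + 1) → Fin n → U, φ.Realize (Sum.elim (↑) fun p => t p.1 p.2) ↔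
          (φ.relabel ρ).Realize (Sum.elim (Sum.elim (↑) fun p => t p.1.castSucc p.2)
            (t (Fin.last k))) := fun t => by
        rw [Formula.realize_relabel]
        refine iff_of_eq (congrArg φ.Realize (funext fun p => ?_))
        rcases p with p | ⟨p, r⟩
        · rfl
        · induction p using Fin.lastCases <;> simp [ρ]
      have hlast : ∀ i : Fin (k + 1) → ℕ, StrictMono i →
          (φ.Realize (Sum.elim (↑) fun p => c (i p.1) p.2) ↔
            ∀ᶠ y : Fin n → N in 𝒱, (φ.relabel ρ).Realize (Sum.elim (Sum.elim (↑)
              fun p => c (i p.1.castSucc) p.2) fun r => (y r : U))) := fun i hi => by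
        rw [hρ fun p => c (i p)]
        refine (hc _).realize_iff _ ?_ _
        rintro (a | p)
        · exact Or.inl a.2
        · exact Or.inr (mem_biUnion (hi (Fin.castSucc_lt_last p.1)) (mem_range_self _))
      rw [hlast i hi, hlast (fun p => p) Fin.val_strictMono]
      refine eventually_congr (Eventually.of_forall fun y => ?_)
      generalize φ.relabel ρ = ψ
      have h := ih (fun p => i p.castSucc) (hi.comp (Fin.strictMono_castSucc))
        (ψ.relabel (Sum.elim id fun r => Sum.inl (y r)))
      rw [Formula.realize_relabel, Formula.realize_relabel, Sum.comp_elim, Sum.comp_elim] at h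
      exact h
  exact fun k i j hi hj φ => (key k i hi φ).trans (key k j hj φ).symm

/-- Two tuples with the same type over a model start indiscernible sequences over it that agree
from the second term on. -/
theorem IsSaturated.exists_common_indiscernible_tail (hU : IsSaturated L U) (hκ : ℵ₀ ≤ #U)
    (hN : #N < #U) (a b : Fin n → U)
    (hab : ∀ φ : L.Formula ((N : Set U) ⊕ Fin n),
      φ.Realize (Sum.elim (↑) a) ↔ φ.Realize (Sum.elim (↑) b)) :
    ∃ c d : ℕ → Fin n → U, IsIndiscernibleOver L (N : Set U) c ∧
      IsIndiscernibleOver L (N : Set U) d ∧ c 0 = a ∧ d 0 = b ∧ c 1 = d 1 := by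
  obtain ⟨𝒱, ha⟩ := exists_ultrafilter_realizesOver N a
  have hb : RealizesOver 𝒱 (N : Set U) b := fun φ => (hab φ).symm.trans (ha φ)
  have hR : ∀ B : Set U, ∃ c, #B < #U → RealizesOver 𝒱 B c := fun B => by
    by_cases hB : #B < #U
    · obtain ⟨c, hc⟩ := hU.exists_realizesOver hκ 𝒱 hB
      exact ⟨c, fun _ => hc⟩
    · exact ⟨a, fun h => absurd h hB⟩
  choose R hR using hR
  -- Starting from `N` together with both `a` and `b`, each term realizes the coheir over everything
  -- before it, so one tail serves both sequences.
  let B : ℕ → Set U := fun k => Nat.rec ((N : Set U) ∪ (range a ∪ range b))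
    (fun _ B => B ∪ range (R B)) k
  have hfin : ∀ c : Fin n → U, #(range c) < #U := fun c =>
    (Cardinal.lt_aleph0_iff_set_finite.2 (finite_range c)).trans_le hκ
  have hunion : ∀ X Y : Set U, #X < #U → #Y < #U → #(X ∪ Y : Set U) < #U := fun X Y hX hY =>
    (Cardinal.mk_union_le X Y).trans_lt (Cardinal.add_lt_of_lt hκ hX hY)
  have hB : ∀ k, #↥(B k) < #U := fun k => by
    induction k with
    | zero => exact hunion _ _ hN (hunion _ _ (hfin a) (hfin b))
    | succ k ih => exact hunion _ _ ih (hfin _)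
  have hBmono : Monotone B := monotone_nat_of_le_succ fun k => subset_union_left
  have hRB : ∀ j k, j < k → range (R (B j)) ⊆ B k := fun j k hjk =>
    subset_union_right.trans (hBmono (Nat.succ_le_of_lt hjk))
  have key : ∀ e : Fin n → U, RealizesOver 𝒱 (N : Set U) e → range e ⊆ range a ∪ range b →
      IsIndiscernibleOver L (N : Set U)
        (fun k => Nat.casesOn k e fun k => R (B k) : ℕ → Fin n → U) := by
    intro e he hr
    refine isIndiscernibleOver_of_realizesOver (𝒱 := 𝒱) fun k => ?_
    cases k with
    | zero => exact he.mono (by simp)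
    | succ k =>
      refine (hR (B k) (hB k)).mono (union_subset
        (subset_union_left.trans (hBmono (Nat.zero_le k))) (iUnion₂_subset fun j hj => ?_))
      cases j with
      | zero => exact (hr.trans subset_union_right).trans (hBmono (Nat.zero_le k))
      | succ j => exact hRB j k (Nat.lt_of_succ_lt_succ hj)
  exact ⟨_, _, key a ha subset_union_left, key b hb subset_union_right, rfl, rfl, rfl⟩

/-- If `f` fixes `N`, then `f ∘ a` and `a` have the same type over `N`; the second term common to
their sequences links their membership in `D`. -/
theorem IsSaturated.isLascarInvariant_of_indiscernible (hU : IsSaturated L U) (hκ : ℵ₀ ≤ #U)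
    {A : Set U} {D : Set (Fin n → U)}
    (h : ∀ c : ℕ → Fin n → U, IsIndiscernibleOver L A c → (c 0 ∈ D ↔ c 1 ∈ D)) :
    IsLascarInvariant L A D := by
  refine fun N hN hAN => isInvariant_iff.2 fun f hf a => ?_
  obtain ⟨c, d, hc, hd, hca, hda, hcd⟩ := hU.exists_common_indiscernible_tail hκ hN (f ∘ a) a
    fun φ => by
      rw [← StrongHomClass.realize_formula f φ (v := Sum.elim _ a), Sum.comp_elim]
      refine iff_of_eq (congrArg (fun e => φ.Realize (Sum.elim e (f ∘ a))) (funext fun r => ?_))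
      exact (hf _ r.2).symm
  rw [← hca, ← hda, h c (hc.mono hAN), h d (hd.mono hAN), hcd]

end Coheir

/-! ### Membership in `D` and subsequences of indiscernible sequences -/

section Sequences

variable {L : FirstOrder.Language.{u, v}} {U : Type w} [L.Structure U] {n : ℕ}

theorem mem_iff_mem_of_isIndiscernibleOverWith {A : Set U} {D : Set (Fin n → U)}
    {I : Type x} [LinearOrder I] {c : I → Fin n → U} (hc : IsIndiscernibleOverWith L A D c)
    (i j : I) : c i ∈ D ↔ c j ∈ D :=
  hc 1 (fun _ => i) (fun _ => j) (Subsingleton.strictMono _)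
    (Subsingleton.strictMono _)
    (Relations.formula (Sum.inr PredicateSymbol.mem) fun r => Term.var (0, r))

theorem IsIndiscernibleOver.comp_strictMono {A : Set U} {m : ℕ} {I : Type*} {J : Type*}
    [LinearOrder I] [LinearOrder J] {c : I → Fin m → U} (hc : IsIndiscernibleOver L A c)
    {g : J → I} (hg : StrictMono g) : IsIndiscernibleOver L A (c ∘ g) :=
  fun k i j hi hj φ => hc k (g ∘ i) (g ∘ j) (hg.comp hi) (hg.comp hj) φ

end Sequences

end LascarInvariance

theorem mainTheorem5 (L : FirstOrder.Language.{u, v}) (U : Type w) [L.Structure U]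
    (hU : LascarInvariance.IsSaturated L U) (hκ : (#U).IsInaccessible)
    (hL : Cardinal.lift.{w} L.card < Cardinal.lift.{max u v} #U)
    (n : ℕ) (D : Set (Fin n → U))
    (A : Set U) (M : L.ElementarySubstructure U) (hM : #M < #U) (hAM : A ⊆ (M : Set U)) :
    List.TFAE [
      LascarInvariance.IsLascarInvariant L A D,
      ∀ C ∈ LascarInvariance.orbit L A D, LascarInvariance.IsInvariant L (M : Set U) C,
      #(LascarInvariance.orbit L A D) < #U,
      ∀ (I : Type x) [LinearOrder I] [NoMaxOrder I] (m : ℕ) (c : I → Fin m → U),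
        LascarInvariance.IsIndiscernibleOver L A c →
          LascarInvariance.IsIndiscernibleOverWith L A D c,
      ∀ c : ℕ → Fin n → U, LascarInvariance.IsIndiscernibleOver L A c → (c 0 ∈ D ↔ c 1 ∈ D)] := by
  open LascarInvariance in
  have hA : #A < #U := (Cardinal.mk_le_mk_of_subset hAM).trans_lt hM
  tfae_have 1 → 2 := fun h C hC => h.isInvariant_of_mem_orbit M hM hAM hC
  tfae_have 2 → 3 := fun h => (Cardinal.mk_le_mk_of_subset h).trans_lt
    (hU.mk_setOf_isInvariant_lt hκ hL hM)
  tfae_have 3 → 4 := fun h I _ _ m c hc => hU.isIndiscernibleOverWith_of_mk_orbit_lt hκ hA h hc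
  tfae_have 4 → 5 := fun h c hc => by
    -- The index orders in 4 live in universe `x`, so `ℕ` is lifted there.
    have : NoMaxOrder (ULift.{x} ℕ) := ⟨fun k => ⟨⟨k.down + 1⟩, Nat.lt_succ_self k.down⟩⟩
    exact mem_iff_mem_of_isIndiscernibleOverWith (h (ULift.{x} ℕ) n (c ∘ ULift.down)
      (hc.comp_strictMono fun _ _ hij => hij)) ⟨0⟩ ⟨1⟩
  tfae_have 5 → 1 := fun h => hU.isLascarInvariant_of_indiscernible hκ.aleph0_lt.le h
  tfae_finish
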